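/- Let $G$ be a finite group and let $\alpha:G\times G\to\mathbb{C}\setminus\{0\}$ be a cocycle, i.e. $\alpha(x,y)\alpha(xy,z)=\alpha(x,yz)\alpha(y,z)$ for all $x,y,z\in G$. A projective representation of $G$ with cocycle $\alpha$ is a map $\rho:G\to \mathrm{GL}(\mathbb{C}^{d_\rho})$ with $\rho(g)\rho(h)=\alpha(g,h)\rho(gh)$ for all $g,h$; it is irreducible if $d_\rho>0$ and its only $G$-invariant subspaces are $0$ and $\mathbb{C}^{d_\rho}$, and (for the fixed $\alpha$) $\rho$ and $\xi$ are equivalent if $\xi=T\rho T^{-1}$ for some invertible $T$. Let $R$ be a complete set of inequivalent irreducible projective representations of $G$ with cocycle $\alpha$, i.e. every irreducible one is equivalent to exactly one element of $R$, and all elements of $R$ are irreducible. For $f,\nu,\mu:G\to\mathbb{C}$, a family of matrices $A=(A_\rho)_{\rho\in R}$ with $A_\rho\in M_{d_\rho}(\mathbb{C})$, and $\rho\in R$, $a,g\in G$, put $$(F_\alpha f)_\rho=\sum_{a\in G}\frac{f(a)\rho(a^{-1})}{\alpha(a,a^{-1})\alpha(1,1)},\qquad (\mathcal F_\alpha f)_\rho=\sum_{a\in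 G}\frac{f(a)\rho(a)}{\alpha(a,a^{-1})\alpha(1,1)},$$ $$(F_\alpha^{-1}A)(a)=\frac1{|G|}\sum_{\rho\in R}d_\rho\,\mathrm{trace}(A_\rho\rho(a)),\qquad (\mathcal F_\alpha^{-1}A)(a)=(F_\alpha^{-1}A)(a^{-1}),$$ $$(\nu*_\alpha\mu)(g)=\sum_{t\in G}\frac{\nu(gt^{-1})\mu(t)}{\alpha(gt^{-1},t)},\qquad \tilde\alpha(a,b)=\alpha(b^{-1},a^{-1}).$$ ($\tilde\alpha$ is again a cocycle.) **Theorem.** The set $R$ is finite, and the following hold. 1. $F_\alpha$ and $F_\alpha^{-1}$ are inverses of each other, as are $\mathcal F_\alpha$ and $\mathcal F_\alpha^{-1}$: $F_\alpha^{-1}F_\alpha f=f=\mathcal F_\alpha^{-1}\mathcal F_\alpha f$ for all $f:G\to\mathbb{C}$, and $F_\alpha F_\alpha^{-1}A=A=\mathcal F_\alpha\mathcal F_\alpha^{-1}A$ for all families $A=(A_\rho)_{\rho\in R}$. 2. For all $\nu,\mu:G\to\mathbb{C}$ and $\rho\in R$, $$(F_\alpha\nu)_\rho(F_\alpha\mu)_\rho=(F_\alpha(\mu*_\alpha\nu))_\rho,\qquad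 (\mathcal F_\alpha\nu)_\rho(\mathcal F_\alpha\mu)_\rho=(\mathcal F_\alpha(\nu*_{\tilde\alpha}\mu))_\rho .$$ 3. For all $\nu,\mu:G\to\mathbb{C}$, $$\sum_{a\in G}\frac{\nu(a)\mu(a^{-1})}{\alpha(a,a^{-1})\alpha(1,1)}=\frac1{|G|}\sum_{\rho\in R}d_\rho\,\mathrm{trace}\bigl((F_\alpha\nu)_\rho(F_\alpha\mu)_\rho\bigr).$$ 4. If every $\rho\in R$ is unitary ($\rho(g)^*=\rho(g)^{-1}$ for all $g$), then for all $\nu,\mu:G\to\mathbb{C}$, $$\sum_{a\in G}\nu(a)\overline{\mu(a)}=\frac1{|G|}\sum_{\rho\in R}d_\rho\,\langle (F_\alpha\nu)_\rho,(F_\alpha\mu)_\rho\rangle,\qquad \langle A,B\rangle:=\mathrm{trace}(AB^*).$$ -/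

import Mathlib

open scoped Matrix ComplexConjugate

namespace TwistedFourier

universe u

/-- A cocycle (multiplier) of a group `G`: a nowhere vanishing map `α : G × G → ℂ` with
`α(x,y) α(xy,z) = α(x,yz) α(y,z)`, that is, an element of `Z²(G, ℂˣ)` for the trivial action.
No normalisation and no unimodularity is required. -/
structure Cocycle (G : Type u) [Group G] where
  toFun : G → G → ℂ
  ne_zero' : ∀ g h, toFun g h ≠ 0
  rule' : ∀ x y z, toFun x y * toFun (x * y) z = toFun x (y * z) * toFun y z

instance (G : Type u) [Group G] : CoeFun (Cocycle G) (fun _ => G → G → ℂ) :=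
  ⟨Cocycle.toFun⟩

/-- The cocycle `α̃(a,b) := α(b⁻¹, a⁻¹)`. -/
def Cocycle.twist {G : Type u} [Group G] (α : Cocycle G) : Cocycle G where
  toFun a b := α b⁻¹ a⁻¹
  ne_zero' _ _ := α.ne_zero' _ _
  rule' x y z := by
    have h := α.rule' z⁻¹ y⁻¹ x⁻¹
    simp only [mul_inv_rev]
    linear_combination -h

/-- A projective representation `ρ : G → GL(ℂ^d)` of `G` with cocycle `α`:
`ρ(g) ρ(h) = α(g,h) ρ(gh)`. -/
structure ProjectiveRep {G : Type u} [Group G] (α : Cocycle G) where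
  /-- the dimension `d_ρ` -/
  dim : ℕ
  toGL : G → GL (Fin dim) ℂ
  map_mul' : ∀ g h, ((toGL g : Matrix (Fin dim) (Fin dim) ℂ) * toGL h)
    = α g h • (toGL (g * h) : Matrix (Fin dim) (Fin dim) ℂ)

namespace ProjectiveRep

variable {G : Type u} [Group G] {α : Cocycle G}

/-- The matrix `ρ(g)`. -/
def mat (ρ : ProjectiveRep α) (g : G) : Matrix (Fin ρ.dim) (Fin ρ.dim) ℂ := (ρ.toGL g).val

/-- `ρ` is irreducible: it is nonzero, and the only `G`-invariant subspaces of `ℂ^d` are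
`0` and `ℂ^d`. -/
def IsIrreducible (ρ : ProjectiveRep α) : Prop :=
  0 < ρ.dim ∧ ∀ W : Submodule ℂ (Fin ρ.dim → ℂ),
    (∀ g : G, ∀ w ∈ W, ρ.mat g *ᵥ w ∈ W) → W = ⊥ ∨ W = ⊤

/-- Equivalence of projective representations for a fixed cocycle: `ξ = T ρ T⁻¹` for an
invertible matrix `T` (with inverse `S`). -/
def Equivalent (ρ ξ : ProjectiveRep α) : Prop :=
  ∃ (T : Matrix (Fin ξ.dim) (Fin ρ.dim) ℂ) (S : Matrix (Fin ρ.dim) (Fin ξ.dim) ℂ),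
    T * S = 1 ∧ S * T = 1 ∧ ∀ g : G, ξ.mat g = T * ρ.mat g * S

/-- `ρ` is unitary: `ρ(g)* = ρ(g)⁻¹` for all `g`. -/
def IsUnitary (ρ : ProjectiveRep α) : Prop :=
  ∀ g : G, (ρ.mat g)ᴴ = (ρ.mat g)⁻¹

end ProjectiveRep

/-- `R` is a complete set of inequivalent irreducible projective representations of `G` for the
cocycle `α`: its members are irreducible, and every irreducible one is equivalent to exactly one
member of `R`. -/
structure IsCompleteSet {G : Type u} [Group G] {α : Cocycle G} (R : Set (ProjectiveRep α)) :
    Prop where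
  irreducible : ∀ ρ ∈ R, ρ.IsIrreducible
  inequivalent : ∀ ρ ∈ R, ∀ ξ ∈ R, ρ.Equivalent ξ → ρ = ξ
  complete : ∀ ξ : ProjectiveRep α, ξ.IsIrreducible → ∃ ρ ∈ R, ρ.Equivalent ξ

section Transforms

variable {G : Type u} [Group G] [Fintype G]

/-- The `α`-convolution `(ν *_α μ)(g) = ∑ₜ ν(g t⁻¹) μ(t) / α(g t⁻¹, t)`. -/
noncomputable def conv (α : Cocycle G) (ν μ : G → ℂ) : G → ℂ :=
  fun g => ∑ t : G, ν (g * t⁻¹) * μ t / α (g * t⁻¹) t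

variable {α : Cocycle G}

/-- The space `⊕_{ρ ∈ R} M_{d_ρ}(ℂ)` of families of matrices `(A_ρ)_{ρ ∈ R}`. -/
abbrev MatFamily (R : Set (ProjectiveRep α)) : Type u :=
  (ρ : R) → Matrix (Fin ρ.1.dim) (Fin ρ.1.dim) ℂ

/-- The `α`-Fourier transform `(F_α f)_ρ = ∑ₐ f(a) ρ(a⁻¹) / (α(a,a⁻¹) α(1,1))`. -/
noncomputable def fourier (R : Set (ProjectiveRep α)) (f : G → ℂ) : MatFamily R :=
  fun ρ => ∑ a : G, (f a / (α a a⁻¹ * α 1 1)) • ρ.1.mat a⁻¹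

/-- The variant `(𝓕_α f)_ρ = ∑ₐ f(a) ρ(a) / (α(a,a⁻¹) α(1,1))`. -/
noncomputable def fourierVar (R : Set (ProjectiveRep α)) (f : G → ℂ) : MatFamily R :=
  fun ρ => ∑ a : G, (f a / (α a a⁻¹ * α 1 1)) • ρ.1.mat a

/-- The inverse `α`-Fourier transform
`(F_α⁻¹ A)(a) = |G|⁻¹ ∑_ρ d_ρ trace(A_ρ ρ(a))`. -/
noncomputable def fourierInv (R : Set (ProjectiveRep α)) [Fintype R] (A : MatFamily R) : G → ℂ :=
  fun a => (Fintype.card G : ℂ)⁻¹ * ∑ ρ : R, (ρ.1.dim : ℂ) * (A ρ * ρ.1.mat a).trace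

/-- The inverse of the variant, `(𝓕_α⁻¹ A)(a) = (F_α⁻¹ A)(a⁻¹)`. -/
noncomputable def fourierVarInv (R : Set (ProjectiveRep α)) [Fintype R] (A : MatFamily R) :
    G → ℂ :=
  fun a => fourierInv R A a⁻¹

end Transforms

end TwistedFourier

/-! Since ρ(a⁻¹) = α(a,a⁻¹)α(1,1) ρ(a)⁻¹, the weights in the transform cancel and (F f)_ρ = ∑ f(a)
ρ(a)⁻¹ (`fourier_apply`). Schur orthogonality computes ∑ trace(B ρ(a)) ξ(a)⁻¹: it is (|G|/d_ρ) B for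
ξ = ρ and 0 for inequivalent ρ, ξ. This gives F F⁻¹ = id, and also the independence of characters,
hence the finiteness of R. The other composite needs F injective rather than the count ∑ d_ρ² = |G|.
By Maschke, an element of the twisted group algebra killed by all irreducibles acts as zero on the
regular representation, so it is zero (`eq_zero_of_forall_irreducible`). The convolution and
Plancherel formulas then follow from the product rule for ρ(gh)⁻¹ and the inversion formula. -/

namespace TwistedFourier

variable {G : Type*} [Group G]

/-! ### Cocycle values at the identity and at inverse pairs. -/

namespace Cocycle

variable (α : Cocycle G)

theorem apply_one_right (g : G) : α g 1 = α 1 1 := by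
  have h := α.rule' g 1 1
  simp only [mul_one] at h
  exact mul_right_cancel₀ (α.ne_zero' g 1) (h.trans (mul_comm _ _))

theorem apply_one_left (g : G) : α 1 g = α 1 1 := by
  have h := α.rule' 1 1 g
  simp only [one_mul] at h
  exact (mul_right_cancel₀ (α.ne_zero' 1 g) h).symm

theorem apply_inv_comm (g : G) : α g g⁻¹ = α g⁻¹ g := by
  have h := α.rule' g g⁻¹ g
  rw [mul_inv_cancel, inv_mul_cancel, apply_one_left, apply_one_right α g, mul_comm] at h
  exact mul_left_cancel₀ (α.ne_zero' 1 1) h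

theorem norm_ne_zero (g : G) : α g g⁻¹ * α 1 1 ≠ 0 :=
  mul_ne_zero (α.ne_zero' _ _) (α.ne_zero' _ _)

end Cocycle

variable {α : Cocycle G}

/-! ### Inverses of representing matrices and Schur's lemma. -/

namespace ProjectiveRep

variable (ρ : ProjectiveRep α)

theorem mat_mul (g h : G) : ρ.mat g * ρ.mat h = α g h • ρ.mat (g * h) := ρ.map_mul' g h

theorem isUnit_det_mat (g : G) : IsUnit (ρ.mat g).det :=
  (Matrix.isUnit_iff_isUnit_det _).1 (ρ.toGL g).isUnit

theorem mat_mul_inv (g : G) : ρ.mat g * (ρ.mat g)⁻¹ = 1 :=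
  Matrix.mul_nonsing_inv _ (ρ.isUnit_det_mat g)

theorem inv_mul_mat (g : G) : (ρ.mat g)⁻¹ * ρ.mat g = 1 :=
  Matrix.nonsing_inv_mul _ (ρ.isUnit_det_mat g)

theorem mat_one : ρ.mat 1 = α 1 1 • (1 : Matrix (Fin ρ.dim) (Fin ρ.dim) ℂ) := by
  have h := congrArg (· * (ρ.mat 1)⁻¹) (ρ.mat_mul 1 1)
  simpa [Matrix.mul_assoc, mat_mul_inv] using h

/-- The source of the weight α(a,a⁻¹)α(1,1) in the transforms. -/
theorem mat_inv (g : G) : ρ.mat g⁻¹ = (α g g⁻¹ * α 1 1) • (ρ.mat g)⁻¹ := by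
  have h := congrArg ((ρ.mat g)⁻¹ * ·) (ρ.mat_mul g g⁻¹)
  simpa [← Matrix.mul_assoc, inv_mul_mat, mat_one, smul_smul] using h

theorem inv_mat_mul (g h : G) :
    (ρ.mat (g * h))⁻¹ = α g h • ((ρ.mat h)⁻¹ * (ρ.mat g)⁻¹) := by
  apply Matrix.inv_eq_left_inv
  have e : ρ.mat (g * h) = (α g h)⁻¹ • (ρ.mat g * ρ.mat h) := by
    rw [mat_mul, smul_smul, inv_mul_cancel₀ (α.ne_zero' g h), one_smul]
  rw [e, Matrix.smul_mul, Matrix.mul_smul, smul_smul, mul_inv_cancel₀ (α.ne_zero' g h), one_smul,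
    Matrix.mul_assoc, ← Matrix.mul_assoc (ρ.mat g)⁻¹, inv_mul_mat, Matrix.one_mul, inv_mul_mat]

variable {ρ} {ξ : ProjectiveRep α}

/-- **Schur's lemma**: an intertwiner of irreducible projective representations is zero or an
equivalence. -/
theorem IsIrreducible.eq_zero_or_equivalent (hρ : ρ.IsIrreducible) (hξ : ξ.IsIrreducible)
    (X : Matrix (Fin ξ.dim) (Fin ρ.dim) ℂ) (hX : ∀ g, ξ.mat g * X = X * ρ.mat g) :
    X = 0 ∨ ρ.Equivalent ξ := by
  have hX' : ∀ g w, X *ᵥ (ρ.mat g *ᵥ w) = ξ.mat g *ᵥ (X *ᵥ w) := fun g w => by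
    rw [Matrix.mulVec_mulVec, Matrix.mulVec_mulVec, hX]
  rcases hρ.2 (LinearMap.ker X.mulVecLin) (fun g w hw => by
    simp only [LinearMap.mem_ker, Matrix.mulVecLin_apply] at hw ⊢
    rw [hX', hw, Matrix.mulVec_zero]) with hk | hk
  · rcases hξ.2 (LinearMap.range X.mulVecLin) (by
      rintro g _ ⟨w, rfl⟩
      exact ⟨ρ.mat g *ᵥ w, hX' g w⟩) with hr | hr
    · left
      have h0 : X.mulVecLin = 0 := LinearMap.range_eq_bot.1 hr
      exact Matrix.toLin'.injective (by simpa [Matrix.toLin'_apply'] using h0)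
    · right
      let e := LinearEquiv.ofBijective X.mulVecLin
        ⟨LinearMap.ker_eq_bot.1 hk, LinearMap.range_eq_top.1 hr⟩
      have he : LinearMap.toMatrix' (e : (Fin ρ.dim → ℂ) →ₗ[ℂ] (Fin ξ.dim → ℂ)) = X :=
        LinearMap.toMatrix'_toLin' X
      have h1 : X * LinearMap.toMatrix' (e.symm : (Fin ξ.dim → ℂ) →ₗ[ℂ] (Fin ρ.dim → ℂ)) = 1 := by
        rw [← he, ← LinearMap.toMatrix'_comp]
        simp
      have h2 : LinearMap.toMatrix' (e.symm : (Fin ξ.dim → ℂ) →ₗ[ℂ] (Fin ρ.dim → ℂ)) * X = 1 := by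
        conv_lhs => rw [← he]
        rw [← LinearMap.toMatrix'_comp]
        simp
      exact ⟨X, _, h1, h2, fun g => by rw [← hX, Matrix.mul_assoc, h1, Matrix.mul_one]⟩
  · left
    have h0 : X.mulVecLin = 0 := LinearMap.ker_eq_top.1 hk
    exact Matrix.toLin'.injective (by simpa [Matrix.toLin'_apply'] using h0)

/-- **Schur's lemma**: a self-intertwiner of an irreducible projective representation is scalar. -/
theorem IsIrreducible.exists_eq_smul_one (hρ : ρ.IsIrreducible)
    (X : Matrix (Fin ρ.dim) (Fin ρ.dim) ℂ) (hX : ∀ g, ρ.mat g * X = X * ρ.mat g) :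
    ∃ c : ℂ, X = c • 1 := by
  have : Nonempty (Fin ρ.dim) := ⟨⟨0, hρ.1⟩⟩
  obtain ⟨c, hc⟩ := Module.End.exists_eigenvalue (Matrix.toLin' X)
  refine ⟨c, ?_⟩
  rcases hρ.2 (Module.End.eigenspace (Matrix.toLin' X) c) (fun g w hw => by
    rw [Module.End.mem_eigenspace_iff, Matrix.toLin'_apply] at hw ⊢
    rw [Matrix.mulVec_mulVec, ← hX, ← Matrix.mulVec_mulVec, hw, Matrix.mulVec_smul]) with h | h
  · exact absurd h hc
  · apply Matrix.toLin'.injective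
    refine LinearMap.ext fun v => ?_
    have hv : v ∈ Module.End.eigenspace (Matrix.toLin' X) c := h ▸ Submodule.mem_top
    rw [Module.End.mem_eigenspace_iff.1 hv]
    simp

/-! ### Schur orthogonality. -/

section Orthogonality

variable [Fintype G]

/-- The average of a matrix over the group intertwines `ρ` and `ξ`. -/
theorem sum_inv_mul_mul_intertwines (X : Matrix (Fin ξ.dim) (Fin ρ.dim) ℂ) (b : G) :
    ξ.mat b * (∑ a, (ξ.mat a)⁻¹ * X * ρ.mat a) = (∑ a, (ξ.mat a)⁻¹ * X * ρ.mat a) * ρ.mat b := by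
  -- After a ↦ ab the same factor α(a,b) appears on both sides: on the left from ξ(ab)⁻¹, on the
  -- right from ρ(a)ρ(b).
  conv_lhs => rw [← Equiv.sum_comp (Equiv.mulRight b)]
  rw [Matrix.mul_sum, Matrix.sum_mul]
  refine Finset.sum_congr rfl fun a _ => ?_
  simp only [Equiv.coe_mulRight]
  rw [inv_mat_mul, Matrix.mul_assoc _ (ρ.mat a), mat_mul]
  simp only [Matrix.smul_mul, Matrix.mul_smul, ← Matrix.mul_assoc, mat_mul_inv, Matrix.one_mul]

/-- Reduces orthogonality to group averages of matrix units, which are intertwiners and so fall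
under Schur's lemma. -/
theorem sum_trace_smul_inv_apply (B : Matrix (Fin ρ.dim) (Fin ρ.dim) ℂ) (i j : Fin ξ.dim) :
    (∑ a, (B * ρ.mat a).trace • (ξ.mat a)⁻¹) i j
      = ∑ l, ∑ k, B l k * (∑ a, (ξ.mat a)⁻¹ * Matrix.single j k (1 : ℂ) * ρ.mat a) i l := by
  simp only [Matrix.sum_apply, Matrix.smul_apply, Matrix.trace, Matrix.diag_apply,
    Matrix.mul_apply (M := B), smul_eq_mul, Finset.sum_mul, Finset.mul_sum]
  rw [Finset.sum_comm]
  refine Finset.sum_congr rfl fun l _ => ?_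
  rw [Finset.sum_comm]
  refine Finset.sum_congr rfl fun k _ => Finset.sum_congr rfl fun a _ => ?_
  have h : ((ξ.mat a)⁻¹ * Matrix.single j k (1 : ℂ) * ρ.mat a) i l
      = (ξ.mat a)⁻¹ i j * ρ.mat a k l := by
    simp [Matrix.mul_apply, Matrix.single_apply, ite_and, Finset.sum_ite_eq]
  rw [h]
  ring

/-- Schur orthogonality for inequivalent representations. -/
theorem sum_trace_smul_inv_of_not_equivalent (hρ : ρ.IsIrreducible) (hξ : ξ.IsIrreducible)
    (h : ¬ ρ.Equivalent ξ) (B : Matrix (Fin ρ.dim) (Fin ρ.dim) ℂ) :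
    ∑ a, (B * ρ.mat a).trace • (ξ.mat a)⁻¹ = 0 := by
  ext i j
  rw [sum_trace_smul_inv_apply]
  refine Finset.sum_eq_zero fun l _ => Finset.sum_eq_zero fun k _ => ?_
  rw [(hρ.eq_zero_or_equivalent hξ _ (sum_inv_mul_mul_intertwines _)).resolve_right h]
  simp

/-- The group average of a matrix under an irreducible representation. -/
theorem IsIrreducible.sum_inv_mul_mul (hρ : ρ.IsIrreducible)
    (X : Matrix (Fin ρ.dim) (Fin ρ.dim) ℂ) :
    ∑ a, (ρ.mat a)⁻¹ * X * ρ.mat a = ((Fintype.card G : ℂ) / ρ.dim * X.trace) • 1 := by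
  obtain ⟨c, hc⟩ := hρ.exists_eq_smul_one _ (sum_inv_mul_mul_intertwines (ξ := ρ) X)
  have hd : (ρ.dim : ℂ) ≠ 0 := Nat.cast_ne_zero.2 hρ.1.ne'
  -- Conjugation preserves the trace, so the scalar satisfies c d_ρ = |G| trace X.
  have ht := congrArg Matrix.trace hc
  have hterm : ∀ a, ((ρ.mat a)⁻¹ * X * ρ.mat a).trace = X.trace := fun a => by
    rw [Matrix.trace_mul_comm, ← Matrix.mul_assoc, mat_mul_inv, Matrix.one_mul]
  simp only [Matrix.trace_sum, hterm, Finset.sum_const, Finset.card_univ, nsmul_eq_mul,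
    Matrix.trace_smul, Matrix.trace_one, Fintype.card_fin, smul_eq_mul] at ht
  rw [hc]
  congr 1
  field_simp
  exact ht.symm

/-- Schur orthogonality for a single irreducible representation. -/
theorem IsIrreducible.sum_trace_smul_inv (hρ : ρ.IsIrreducible)
    (B : Matrix (Fin ρ.dim) (Fin ρ.dim) ℂ) :
    ∑ a, (B * ρ.mat a).trace • (ρ.mat a)⁻¹ = ((Fintype.card G : ℂ) / ρ.dim) • B := by
  ext i j
  rw [sum_trace_smul_inv_apply]
  simp only [hρ.sum_inv_mul_mul, Matrix.smul_apply, Matrix.one_apply, smul_eq_mul]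
  rw [Finset.sum_eq_single i, Finset.sum_eq_single j]
  · simp [Matrix.trace_single_eq_same, mul_comm]
  · intro k _ hk
    simp [Matrix.trace_single_eq_of_ne j k (1 : ℂ) hk.symm]
  · simp
  · intro l _ hl
    simp [hl.symm]
  · simp

end Orthogonality

end ProjectiveRep

/-! ### Invariant subspaces and complete reducibility. -/

section Operators

variable {V : Type*} [AddCommGroup V] [Module ℂ V] {L : G → Module.End ℂ V}

/-- The projective representation on an invariant subspace, in coordinates. -/
noncomputable def restrictRep (L : G → Module.End ℂ V) (hL : ∀ g h, L g * L h = α g h • L (g * h))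
    (h1 : L 1 = α 1 1 • 1) (W : Submodule ℂ V) (hW : ∀ g, ∀ w ∈ W, L g w ∈ W)
    {n : ℕ} (b : Module.Basis (Fin n) ℂ W) : ProjectiveRep α :=
  have key : ∀ g h, LinearMap.toMatrix b b ((L g).restrict (hW g))
      * LinearMap.toMatrix b b ((L h).restrict (hW h))
      = α g h • LinearMap.toMatrix b b ((L (g * h)).restrict (hW (g * h))) := fun g h => by
    rw [← LinearMap.toMatrix_mul, ← map_smul]
    congr 1
    ext w
    simpa using LinearMap.congr_fun (hL g h) (w : V)
  have key1 : LinearMap.toMatrix b b ((L 1).restrict (hW 1)) = α 1 1 • 1 := by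
    rw [← LinearMap.toMatrix_one b, ← map_smul]
    congr 1
    ext w
    simpa using LinearMap.congr_fun h1 (w : V)
  { dim := n
    toGL := fun g =>
      { val := LinearMap.toMatrix b b ((L g).restrict (hW g))
        inv := (α g g⁻¹ * α 1 1)⁻¹ • LinearMap.toMatrix b b ((L g⁻¹).restrict (hW g⁻¹))
        val_inv := by
          rw [Matrix.mul_smul, key, mul_inv_cancel, key1, smul_smul, smul_smul,
            mul_assoc, inv_mul_cancel₀ (α.norm_ne_zero g), one_smul]
        inv_val := by
          rw [Matrix.smul_mul, key, inv_mul_cancel, key1, smul_smul, smul_smul,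
            mul_assoc, ← α.apply_inv_comm, inv_mul_cancel₀ (α.norm_ne_zero g), one_smul] }
    map_mul' := key }

theorem restrictRep_mulVec (hL : ∀ g h, L g * L h = α g h • L (g * h))
    (h1 : L 1 = α 1 1 • 1) (W : Submodule ℂ V) (hW : ∀ g, ∀ w ∈ W, L g w ∈ W)
    {n : ℕ} (b : Module.Basis (Fin n) ℂ W) (g : G) (w : W) :
    (restrictRep L hL h1 W hW b).mat g *ᵥ (b.equivFun w : Fin n → ℂ)
      = b.equivFun ⟨L g w, hW g w w.2⟩ :=
  LinearMap.toMatrix_mulVec_repr b b ((L g).restrict (hW g)) w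

theorem restrictRep_isIrreducible (hL : ∀ g h, L g * L h = α g h • L (g * h))
    (h1 : L 1 = α 1 1 • 1) (W : Submodule ℂ V) (hW : ∀ g, ∀ w ∈ W, L g w ∈ W)
    {n : ℕ} (b : Module.Basis (Fin n) ℂ W) (hW0 : W ≠ ⊥)
    (hmin : ∀ U ≤ W, (∀ g, ∀ u ∈ U, L g u ∈ U) → U ≠ ⊥ → U = W) :
    (restrictRep L hL h1 W hW b).IsIrreducible := by
  refine ⟨?_, fun U hU => ?_⟩
  · rcases Nat.eq_zero_or_pos n with rfl | h
    · have : Subsingleton W := b.equivFun.toEquiv.subsingleton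
      exact absurd (Submodule.subsingleton_iff_eq_bot.1 ‹_›) hW0
    · exact h
  · revert U
    change ∀ U : Submodule ℂ (Fin n → ℂ),
      (∀ g, ∀ w ∈ U, (restrictRep L hL h1 W hW b).mat g *ᵥ w ∈ U) → U = ⊥ ∨ U = ⊤
    intro U hU
    -- Coordinates are undone so that the minimality of `W`, stated in `V`, can be applied.
    let U' : Submodule ℂ V := (U.comap (b.equivFun : W →ₗ[ℂ] Fin n → ℂ)).map W.subtype
    have hmem : ∀ w : W, (w : V) ∈ U' ↔ b.equivFun w ∈ U := fun w => by
      simp [U']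
    have hle : U' ≤ W := Submodule.map_subtype_le _ _
    by_cases h0 : U' = ⊥
    · left
      rw [eq_bot_iff]
      intro x hx
      obtain ⟨w, rfl⟩ := b.equivFun.surjective x
      have hw : (w : V) ∈ U' := (hmem w).2 hx
      rw [h0, Submodule.mem_bot, ZeroMemClass.coe_eq_zero] at hw
      simp [hw]
    · right
      have hUW := hmin U' hle (fun g u hu => by
        have hu' := hU g _ ((hmem ⟨u, hle hu⟩).1 hu)
        rw [restrictRep_mulVec] at hu'
        exact (hmem ⟨L g u, hW g u (hle hu)⟩).2 hu') h0
      rw [eq_top_iff]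
      intro x _
      obtain ⟨w, rfl⟩ := b.equivFun.surjective x
      exact (hmem w).1 (hUW.symm ▸ w.2 : (w : V) ∈ U')

/-- A nonzero invariant subspace contains a minimal one. -/
theorem exists_minimal_invariant [FiniteDimensional ℂ V] {ι : Type*}
    {L : ι → Module.End ℂ V} (U : Submodule ℂ V) (hU : ∀ g, ∀ u ∈ U, L g u ∈ U)
    (hU0 : U ≠ ⊥) :
    ∃ W ≤ U, (∀ g, ∀ w ∈ W, L g w ∈ W) ∧ W ≠ ⊥ ∧
      ∀ W' ≤ W, (∀ g, ∀ w ∈ W', L g w ∈ W') → W' ≠ ⊥ → W' = W := by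
  obtain ⟨W, ⟨hWU, hW, hW0⟩, hmin⟩ := wellFounded_lt.has_min
    {W : Submodule ℂ V | W ≤ U ∧ (∀ g, ∀ w ∈ W, L g w ∈ W) ∧ W ≠ ⊥} ⟨U, le_rfl, hU, hU0⟩
  refine ⟨W, hWU, hW, hW0, fun W' hle hinv h0 => ?_⟩
  by_contra hne
  exact hmin W' ⟨hle.trans hWU, hinv, h0⟩ (lt_of_le_of_ne hle hne)

variable [Fintype G]

/-- **Maschke's theorem** for projective representations. -/
theorem exists_invariant_complement (hL : ∀ g h, L g * L h = α g h • L (g * h))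
    (h1 : L 1 = α 1 1 • 1) (K : Submodule ℂ V) (hK : ∀ g, ∀ v ∈ K, L g v ∈ K) :
    ∃ U : Submodule ℂ V, (∀ g, ∀ v ∈ U, L g v ∈ U) ∧ IsCompl K U := by
  obtain ⟨p, hp⟩ := K.subtype.exists_leftInverse_of_injective K.ker_subtype
  let q : Module.End ℂ V := K.subtype ∘ₗ p
  have hqK : ∀ v, q v ∈ K := fun v => (p v).2
  have hq : ∀ v ∈ K, q v = v := fun v hv =>
    congrArg Subtype.val (LinearMap.congr_fun hp ⟨v, hv⟩)
  let M : G → Module.End ℂ V := fun g => (α g g⁻¹ * α 1 1)⁻¹ • L g⁻¹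
  have hML : ∀ g, M g * L g = 1 := fun g => by
    simp only [M, smul_mul_assoc]
    rw [hL, inv_mul_cancel, h1, smul_smul, smul_smul, mul_assoc, ← α.apply_inv_comm,
      inv_mul_cancel₀ (α.norm_ne_zero g), one_smul]
  have hLM : ∀ g, L g * M g = 1 := fun g => by
    simp only [M, mul_smul_comm]
    rw [hL, mul_inv_cancel, h1, smul_smul, smul_smul, mul_assoc,
      inv_mul_cancel₀ (α.norm_ne_zero g), one_smul]
  have hM : ∀ g h, M (g * h) = α g h • (M h * M g) := fun g h => by
    refine left_inv_eq_right_inv (hML _) ?_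
    rw [mul_smul_comm, ← smul_mul_assoc, ← hL, mul_assoc, ← mul_assoc (L h), hLM, one_mul, hLM]
  -- Averaging the projection `q` keeps it a projection onto the invariant `K` and makes it commute
  -- with every `L b`; its kernel is the complement.
  let Q : Module.End ℂ V := (Fintype.card G : ℂ)⁻¹ • ∑ a, M a * q * L a
  have hQ : ∀ b, Q * L b = L b * Q := fun b => by
    simp only [Q, smul_mul_assoc, mul_smul_comm]
    congr 1
    conv_rhs => rw [← Equiv.sum_comp (Equiv.mulRight b)]
    rw [Finset.mul_sum, Finset.sum_mul]
    refine Finset.sum_congr rfl fun a _ => ?_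
    simp only [Equiv.coe_mulRight]
    rw [hM, mul_assoc _ (L a), hL]
    simp only [smul_mul_assoc, mul_smul_comm, ← mul_assoc, hLM, one_mul]
  have hproj : LinearMap.IsProj K Q := by
    refine ⟨fun v => ?_, fun v hv => ?_⟩
    · simp only [Q, LinearMap.smul_apply, LinearMap.sum_apply, Module.End.mul_apply, M]
      exact K.smul_mem _ (K.sum_mem fun a _ => K.smul_mem _ (hK _ _ (hqK _)))
    · have hterm : ∀ a, (M a * q * L a) v = v := fun a => by
        rw [Module.End.mul_apply, Module.End.mul_apply, hq _ (hK a v hv), ← Module.End.mul_apply,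
          hML, Module.End.one_apply]
      simp only [Q, LinearMap.smul_apply, LinearMap.sum_apply, hterm, Finset.sum_const,
        Finset.card_univ]
      rw [← Nat.cast_smul_eq_nsmul ℂ, smul_smul,
        inv_mul_cancel₀ (Nat.cast_ne_zero.2 Fintype.card_ne_zero), one_smul]
  refine ⟨LinearMap.ker Q, fun g v hv => ?_, hproj.isCompl⟩
  rw [LinearMap.mem_ker] at hv ⊢
  rw [← Module.End.mul_apply, hQ, Module.End.mul_apply, hv, map_zero]

/-- An element of the twisted group algebra that vanishes in every irreducible projective
representation acts as zero in every projective representation. -/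
theorem sum_smul_eq_zero_of_irreducible [FiniteDimensional ℂ V]
    (hL : ∀ g h, L g * L h = α g h • L (g * h))
    (h1 : L 1 = α 1 1 • 1) (c : G → ℂ)
    (hc : ∀ ρ : ProjectiveRep α, ρ.IsIrreducible → ∑ a, c a • ρ.mat a = 0) :
    ∑ a, c a • L a = 0 := by
  set T : Module.End ℂ V := ∑ a, c a • L a with hT
  -- The largest invariant subspace killed by `T`; `ker T` itself need not be invariant.
  let K : Submodule ℂ V := ⨅ b, LinearMap.ker (T * L b)
  have hmemK : ∀ v, v ∈ K ↔ ∀ b, T (L b v) = 0 := fun v => by simp [K, Submodule.mem_iInf]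
  have hKinv : ∀ g, ∀ v ∈ K, L g v ∈ K := fun g v hv => (hmemK _).2 fun b => by
    rw [← Module.End.mul_apply (L b), hL, LinearMap.smul_apply, map_smul, (hmemK v).1 hv, smul_zero]
  obtain ⟨U, hU, hKU⟩ := exists_invariant_complement hL h1 K hKinv
  -- A minimal invariant subspace of `U` would be irreducible, hence killed by `T` and contained in
  -- `K`, against disjointness.
  have hU0 : U = ⊥ := by
    by_contra hne
    obtain ⟨W, hWU, hW, hW0, hmin⟩ := exists_minimal_invariant U hU hne
    let b := Module.finBasis ℂ W
    have hzero := hc _ (restrictRep_isIrreducible hL h1 W hW b hW0 hmin)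
    have hTW : ∀ w ∈ W, T w = 0 := fun w hw => by
      let ρ := restrictRep L hL h1 W hW b
      let v : Fin ρ.dim → ℂ := b.equivFun ⟨w, hw⟩
      have h : ∑ a, c a • (ρ.mat a *ᵥ v) = 0 := by
        simp only [← Matrix.smul_mulVec, ← Matrix.sum_mulVec]
        rw [hzero, Matrix.zero_mulVec]
      have h' : b.equivFun (∑ a, c a • (⟨L a w, hW a w hw⟩ : W)) = 0 := by
        refine (map_sum _ _ _).trans (Eq.trans ?_ h)
        refine Finset.sum_congr rfl fun a _ => ?_
        exact (map_smul _ _ _).trans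
          (congrArg (c a • ·) (restrictRep_mulVec hL h1 W hW b a ⟨w, hw⟩).symm)
      have h'' := congrArg Subtype.val ((map_eq_zero_iff _ b.equivFun.injective).1 h')
      simpa [hT, LinearMap.sum_apply] using h''
    have hWK : W ≤ K := fun w hw => (hmemK w).2 fun g => hTW _ (hW g w hw)
    exact hW0 (le_bot_iff.1 (hKU.disjoint hWK hWU))
  have hKtop : K = ⊤ := by simpa [hU0] using hKU.sup_eq_top
  refine LinearMap.ext fun v => ?_
  have h := (hmemK v).1 (hKtop ▸ Submodule.mem_top) 1
  rw [h1] at h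
  simpa [α.ne_zero'] using h

end Operators

/-! ### Faithfulness of the regular representation. -/

section Regular

/-- The regular projective representation of `G` on functions. -/
def regular (α : Cocycle G) (g : G) : Module.End ℂ (G → ℂ) where
  toFun φ x := α g (g⁻¹ * x) * φ (g⁻¹ * x)
  map_add' φ ψ := by
    ext x
    simp [mul_add]
  map_smul' c φ := by
    ext x
    simp [mul_left_comm]

theorem regular_apply (g : G) (φ : G → ℂ) (x : G) :
    regular α g φ x = α g (g⁻¹ * x) * φ (g⁻¹ * x) := rfl

theorem regular_mul (g h : G) : regular α g * regular α h = α g h • regular α (g * h) := by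
  refine LinearMap.ext fun φ => funext fun x => ?_
  have hr := α.rule' g h (h⁻¹ * (g⁻¹ * x))
  rw [mul_inv_cancel_left] at hr
  simp only [Module.End.mul_apply, LinearMap.smul_apply, Pi.smul_apply, regular_apply, smul_eq_mul,
    mul_inv_rev, mul_assoc]
  linear_combination -(φ (h⁻¹ * (g⁻¹ * x))) * hr

theorem regular_one : regular α 1 = α 1 1 • 1 := by
  refine LinearMap.ext fun φ => funext fun x => ?_
  simp [regular_apply, α.apply_one_left x]

/-- The irreducible projective representations separate the points of the twisted group algebra. -/
theorem eq_zero_of_forall_irreducible [Fintype G] (c : G → ℂ)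
    (hc : ∀ ρ : ProjectiveRep α, ρ.IsIrreducible → ∑ a, c a • ρ.mat a = 0) : c = 0 := by
  classical
  have h := sum_smul_eq_zero_of_irreducible (regular_mul (α := α)) regular_one c hc
  ext x
  -- Applied to the delta function at 1, the operator takes the value c(x) α(x,1) at x.
  have hx := congrFun (LinearMap.congr_fun h (Pi.single 1 1)) x
  have hsingle : ∀ a, (Pi.single 1 1 : G → ℂ) (a⁻¹ * x) = if a = x then 1 else 0 := fun a => by
    simp [Pi.single_apply, inv_mul_eq_one]
  simpa [LinearMap.sum_apply, regular_apply, hsingle, α.ne_zero'] using hx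

end Regular

/-! ### Convolution, inversion and Plancherel formulas. -/

section Transform

variable [Fintype G] {R : Set (ProjectiveRep α)}

theorem fourier_apply (f : G → ℂ) (ρ : R) :
    fourier R f ρ = ∑ a, f a • (ρ.1.mat a)⁻¹ := by
  refine Finset.sum_congr rfl fun a _ => ?_
  rw [ProjectiveRep.mat_inv, smul_smul, div_mul_cancel₀ _ (α.norm_ne_zero a)]

theorem fourierVar_eq_fourier (f : G → ℂ) : fourierVar R f = fourier R fun a => f a⁻¹ := by
  funext ρ
  simp only [fourierVar, fourier]
  rw [← Equiv.sum_comp (Equiv.inv G)]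
  refine Finset.sum_congr rfl fun a _ => ?_
  simp only [Equiv.inv_apply, inv_inv]
  rw [α.apply_inv_comm a]

/-- Inverting ρ(ba) reverses the factors, which swaps ν and μ, and yields the α(b,a) that cancels
the denominator of the convolution. -/
theorem fourier_mul_fourier (ν μ : G → ℂ) (ρ : R) :
    fourier R ν ρ * fourier R μ ρ = fourier R (conv α μ ν) ρ := by
  simp only [fourier_apply, conv, Matrix.sum_mul, Matrix.mul_sum, Finset.sum_smul]
  conv_lhs => rw [Finset.sum_comm]
  conv_rhs => rw [Finset.sum_comm]
  refine Finset.sum_congr rfl fun a _ => ?_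
  conv_rhs => rw [← Equiv.sum_comp (Equiv.mulRight a)]
  refine Finset.sum_congr rfl fun b _ => ?_
  simp only [Equiv.coe_mulRight, mul_inv_cancel_right]
  rw [ProjectiveRep.inv_mat_mul, smul_smul, Matrix.smul_mul, Matrix.mul_smul, smul_smul,
    div_mul_cancel₀ _ (α.ne_zero' b a), mul_comm]

theorem conv_twist_inv (ν μ : G → ℂ) (g : G) :
    conv α.twist ν μ g⁻¹ = conv α (fun a => μ a⁻¹) (fun a => ν a⁻¹) g := by
  simp only [conv]
  rw [← Equiv.sum_comp (Equiv.mulRight g) (fun t => μ (g * t⁻¹)⁻¹ * ν t⁻¹ / α (g * t⁻¹) t)]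
  refine Finset.sum_congr rfl fun t _ => ?_
  simp [Cocycle.twist, mul_comm]

theorem fourierVar_mul_fourierVar (ν μ : G → ℂ) (ρ : R) :
    fourierVar R ν ρ * fourierVar R μ ρ = fourierVar R (conv α.twist ν μ) ρ := by
  simp only [fourierVar_eq_fourier, fourier_mul_fourier, conv_twist_inv]

namespace IsCompleteSet

variable (hR : IsCompleteSet R)
include hR

theorem sum_trace_smul_inv_of_ne {ρ ξ : R} (h : ρ ≠ ξ)
    (B : Matrix (Fin ρ.1.dim) (Fin ρ.1.dim) ℂ) :
    ∑ a, (B * ρ.1.mat a).trace • (ξ.1.mat a)⁻¹ = 0 :=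
  ProjectiveRep.sum_trace_smul_inv_of_not_equivalent (hR.irreducible _ ρ.2) (hR.irreducible _ ξ.2)
    (fun he => h (Subtype.ext (hR.inequivalent _ ρ.2 _ ξ.2 he))) B

/-- Gives finiteness of R, as the functions on G form a finite-dimensional space. -/
theorem linearIndependent_trace :
    LinearIndependent ℂ fun (ρ : R) (a : G) => (ρ.1.mat a).trace := by
  classical
  rw [linearIndependent_iff']
  intro s c hc ξ hξ
  have hirr := hR.irreducible _ ξ.2
  have hd : (ξ.1.dim : ℂ) ≠ 0 := Nat.cast_ne_zero.2 hirr.1.ne'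
  have : Nonempty (Fin ξ.1.dim) := ⟨⟨0, hirr.1⟩⟩
  -- Orthogonality with B = 1 isolates the coefficient of ξ.
  have hsum : ∑ ρ ∈ s, c ρ • ∑ a, (1 * ρ.1.mat a).trace • (ξ.1.mat a)⁻¹ = 0 := by
    simp only [Finset.smul_sum, Matrix.one_mul]
    rw [Finset.sum_comm]
    refine Finset.sum_eq_zero fun a _ => ?_
    have ha := congrFun hc a
    simp only [Finset.sum_apply, Pi.smul_apply, smul_eq_mul, Pi.zero_apply] at ha
    simp only [smul_smul]
    rw [← Finset.sum_smul, ha, zero_smul]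
  rw [Finset.sum_eq_single ξ (fun ρ _ hρ => by
    rw [hR.sum_trace_smul_inv_of_ne hρ, smul_zero]) (fun h => absurd hξ h),
    hirr.sum_trace_smul_inv, smul_smul, smul_eq_zero] at hsum
  rcases hsum with h | h
  · simpa [hd] using h
  · exact absurd h one_ne_zero

/-- A complete set of inequivalent irreducible projective representations is finite. -/
theorem finite : R.Finite :=
  have := hR.linearIndependent_trace.finite
  Set.toFinite R

/-- Each irreducible is conjugate to a member of R, so vanishing on R propagates to all
irreducibles. -/
theorem eq_zero_of_fourier_eq_zero (f : G → ℂ) (hf : fourier R f = 0) : f = 0 := by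
  have h := eq_zero_of_forall_irreducible (α := α)
    (fun a => f a⁻¹ / (α a a⁻¹ * α 1 1)) fun ξ hξ => by
    obtain ⟨ρ, hρ, T, S, -, -, hT⟩ := hR.complete ξ hξ
    have hρ0 : fourierVar R (fun a => f a⁻¹) ⟨ρ, hρ⟩ = 0 := by
      simp only [fourierVar_eq_fourier, inv_inv]
      exact congrFun hf _
    have e : ∑ a, (f a⁻¹ / (α a a⁻¹ * α 1 1)) • ξ.mat a
        = T * fourierVar R (fun a => f a⁻¹) ⟨ρ, hρ⟩ * S := by
      simp only [fourierVar, Matrix.mul_sum, Matrix.sum_mul, hT, Matrix.mul_smul, Matrix.smul_mul]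
    rw [e, hρ0, Matrix.mul_zero, Matrix.zero_mul]
  ext a
  simpa [α.ne_zero'] using congrFun h a⁻¹

variable [Fintype R]

theorem fourier_fourierInv (A : MatFamily R) : fourier R (fourierInv R A) = A := by
  classical
  funext ξ
  have hirr := hR.irreducible _ ξ.2
  have hd : (ξ.1.dim : ℂ) ≠ 0 := Nat.cast_ne_zero.2 hirr.1.ne'
  have e : fourier R (fourierInv R A) ξ = (Fintype.card G : ℂ)⁻¹ •
      ∑ ρ : R, (ρ.1.dim : ℂ) • ∑ a, (A ρ * ρ.1.mat a).trace • (ξ.1.mat a)⁻¹ := by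
    simp only [fourier_apply, fourierInv, Finset.smul_sum, Finset.mul_sum, Finset.sum_smul]
    rw [Finset.sum_comm]
    simp only [smul_smul]
  rw [e, Finset.sum_eq_single ξ (fun ρ _ hρ => by
    rw [hR.sum_trace_smul_inv_of_ne hρ, smul_zero]) (by simp), hirr.sum_trace_smul_inv, smul_smul,
    smul_smul]
  have hG : (Fintype.card G : ℂ) ≠ 0 := Nat.cast_ne_zero.2 Fintype.card_ne_zero
  have h1 : (Fintype.card G : ℂ)⁻¹ * ξ.1.dim * (Fintype.card G / ξ.1.dim) = 1 := by field_simp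
  rw [h1, one_smul]

/-- An injective additive map with a right inverse has it as a two-sided inverse. -/
theorem fourierInv_fourier (f : G → ℂ) : fourierInv R (fourier R f) = f := by
  rw [← sub_eq_zero]
  apply hR.eq_zero_of_fourier_eq_zero
  have h := hR.fourier_fourierInv (fourier R f)
  rw [← sub_eq_zero] at h
  rw [← h]
  funext ρ
  simp only [fourier_apply, Pi.sub_apply, sub_smul, Finset.sum_sub_distrib]

theorem plancherel_bilinear (ν μ : G → ℂ) :
    ∑ a : G, ν a * μ a⁻¹ / (α a a⁻¹ * α 1 1)
      = (Fintype.card G : ℂ)⁻¹ * ∑ ρ : R, (ρ.1.dim : ℂ) *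
          (fourier R ν ρ * fourier R μ ρ).trace := by
  -- At the identity ρ(1) is the scalar α(1,1), so inversion leaves only the trace of the product.
  have h := congrFun (hR.fourierInv_fourier (conv α μ ν)) 1
  simp only [fourierInv, ← fourier_mul_fourier, ProjectiveRep.mat_one, Matrix.mul_smul,
    Matrix.mul_one, Matrix.trace_smul, smul_eq_mul, conv, one_mul] at h
  have hα := α.ne_zero' 1 1
  have hl : ∑ a : G, ν a * μ a⁻¹ / (α a a⁻¹ * α 1 1)
      = (α 1 1)⁻¹ * ∑ t, μ t⁻¹ * ν t / α t⁻¹ t := by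
    rw [Finset.mul_sum]
    refine Finset.sum_congr rfl fun a _ => ?_
    rw [α.apply_inv_comm]
    have := α.ne_zero' a⁻¹ a
    field_simp
  rw [hl, ← h]
  simp only [Finset.mul_sum]
  refine Finset.sum_congr rfl fun ρ _ => ?_
  field_simp

theorem plancherel_unitary (hu : ∀ ρ ∈ R, ρ.IsUnitary) (ν μ : G → ℂ) :
    ∑ a : G, ν a * conj (μ a)
      = (Fintype.card G : ℂ)⁻¹ * ∑ ρ : R, (ρ.1.dim : ℂ) *
          (fourier R ν ρ * (fourier R μ ρ)ᴴ).trace := by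
  -- Unitarity turns (ρ(b)⁻¹)* into ρ(b), so pairing with it reproduces the inversion formula for ν.
  have hstar : ∀ ρ : R, (fourier R μ ρ)ᴴ = ∑ b, conj (μ b) • ρ.1.mat b := fun ρ => by
    rw [fourier_apply, Matrix.conjTranspose_sum]
    refine Finset.sum_congr rfl fun b _ => ?_
    rw [Matrix.conjTranspose_smul, ← hu ρ.1 ρ.2 b, Matrix.conjTranspose_conjTranspose]
    rfl
  have h : ∀ a, ν a * conj (μ a) = fourierInv R (fourier R ν) a * conj (μ a) := fun a => by
    rw [hR.fourierInv_fourier]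
  simp only [h, hstar, fourierInv, Matrix.mul_smul, Matrix.trace_sum,
    Matrix.trace_smul, smul_eq_mul, Finset.mul_sum, Finset.sum_mul]
  rw [Finset.sum_comm]
  refine Finset.sum_congr rfl fun ρ _ => Finset.sum_congr rfl fun a _ => ?_
  ring

end IsCompleteSet

end Transform

end TwistedFourier

/-- The finiteness of `R` is part of the conclusion; it gives meaning to the sums over `R`. -/
theorem mainTheorem2 {G : Type*} [Group G] [Fintype G] (α : TwistedFourier.Cocycle G)
    (R : Set (TwistedFourier.ProjectiveRep α)) (hR : TwistedFourier.IsCompleteSet R) :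
    R.Finite ∧ ∀ [Fintype R],
      -- the transforms and their inverses
      (∀ f : G → ℂ, TwistedFourier.fourierInv R (TwistedFourier.fourier R f) = f) ∧
      (∀ A : TwistedFourier.MatFamily R,
        TwistedFourier.fourier R (TwistedFourier.fourierInv R A) = A) ∧
      (∀ f : G → ℂ, TwistedFourier.fourierVarInv R (TwistedFourier.fourierVar R f) = f) ∧
      (∀ A : TwistedFourier.MatFamily R,
        TwistedFourier.fourierVar R (TwistedFourier.fourierVarInv R A) = A) ∧
      -- the convolution formulas
      (∀ (ν μ : G → ℂ) (ρ : R),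
        TwistedFourier.fourier R ν ρ * TwistedFourier.fourier R μ ρ
          = TwistedFourier.fourier R (TwistedFourier.conv α μ ν) ρ) ∧
      (∀ (ν μ : G → ℂ) (ρ : R),
        TwistedFourier.fourierVar R ν ρ * TwistedFourier.fourierVar R μ ρ
          = TwistedFourier.fourierVar R (TwistedFourier.conv α.twist ν μ) ρ) ∧
      -- the Plancherel formulas
      (∀ ν μ : G → ℂ,
        ∑ a : G, ν a * μ a⁻¹ / (α a a⁻¹ * α 1 1)
          = (Fintype.card G : ℂ)⁻¹ * ∑ ρ : R, (ρ.1.dim : ℂ) *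
              (TwistedFourier.fourier R ν ρ * TwistedFourier.fourier R μ ρ).trace) ∧
      ((∀ ρ ∈ R, ρ.IsUnitary) → ∀ ν μ : G → ℂ,
        ∑ a : G, ν a * conj (μ a)
          = (Fintype.card G : ℂ)⁻¹ * ∑ ρ : R, (ρ.1.dim : ℂ) *
              (TwistedFourier.fourier R ν ρ * (TwistedFourier.fourier R μ ρ)ᴴ).trace) := by
  refine ⟨hR.finite, fun {_} => ⟨hR.fourierInv_fourier, hR.fourier_fourierInv, fun f => ?_,
    fun A => ?_, TwistedFourier.fourier_mul_fourier, TwistedFourier.fourierVar_mul_fourierVar,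
    hR.plancherel_bilinear, hR.plancherel_unitary⟩⟩
  · funext a
    rw [TwistedFourier.fourierVarInv, TwistedFourier.fourierVar_eq_fourier,
      hR.fourierInv_fourier, inv_inv]
  · simp only [TwistedFourier.fourierVar_eq_fourier, TwistedFourier.fourierVarInv, inv_inv]
    exact hR.fourier_fourierInv A
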